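/- A \emph{set system} $D=(E,\mathcal F)$ is a finite set $E$ with a collection $\mathcal F$ of subsets of $E$ (the feasible sets). For $e\in E$, call $e$ a coloop if it is in every feasible set and a loop if it is in no feasible set. If $e$ is not a coloop, let $D\setminus e=(E-e,\{F\in\mathcal F\mid F\subseteq E-e\})$; if $e$ is not a loop, let $D/e=(E-e,\{F-e\mid F\in\mathcal F,\ e\in F\})$; if $e$ is a loop or a coloop, then $D\setminus e$ and $D/e$ both denote the one of these that is defined. A \emph{minor} of $D$ is a set system obtained from $D$ by a sequence of deletions and contractions of elements. A \emph{ribbon graph} $G=(V,E)$ is a surface with boundary, represented as the union of a finite set $V$ of discs (vertices) and a finite set $E$ of discs (edges), where the vertices and edges intersect in disjoint line segments, each such segment lies on the boundary of precisely one vertex and precisely one edge, and every edge contains exactly two such segments. Ribbon graphs are considered up to homeomorphisms that preserve vertices, edges and edge labels. For $A\subseteq E$, let $f(A)$ be the number of boundary components of the spanning ribbon subgraph $(V,A)$, and let $k(G)$ be the number of connected components of $G$. Let $D(G)=(E,\mathcal F(G))$ with $\mathcal F(G)=\{A\subseteq E\mid f(A)=k(G)\}$, the delta-matroid whose feasible sets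 are the edge sets of the spanning quasi-trees of $G$. For an edge $e$ with incident vertices $u,v$ (possibly equal), $G\setminus e=(V,E-e)$, and $G/e$ is obtained by attaching a disc (a new vertex) along each boundary component of $e\cup u\cup v$ and then deleting $e$, $u$ and $v$. A \emph{minor} of $G$ is a ribbon graph obtained from $G$ by a sequence of edge deletions, edge contractions and vertex deletions (a vertex being deleted together with its incident edges). \textbf{Proposition.} Let $G$ be a ribbon graph. \begin{enumerate} \item For every edge $e$ of $G$, $D(G\setminus e)=D(G)\setminus e$ and $D(G/e)=D(G)/e$. \item If a ribbon graph $H$ is a minor of $G$, then $D(H)$ is a minor of $D(G)$. \end{enumerate} -/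

import Mathlib

/-! ## Set systems, deletion, contraction and minors -/

/-- A set system `(E, 𝓕)`: a finite ground set `E` and a collection `𝓕` of subsets of `E`. -/
@[ext]
structure SetSystem (α : Type*) where
  ground : Finset α
  feasible : Set (Finset α)
  subset_ground : ∀ F ∈ feasible, F ⊆ ground

namespace SetSystem

variable {α : Type*}

/-- `e` is a loop of `D` if it is an element of the ground set in no feasible set. -/
def IsLoop (D : SetSystem α) (e : α) : Prop := e ∈ D.ground ∧ ∀ F ∈ D.feasible, e ∉ F

/-- `e` is a coloop of `D` if it is an element of the ground set in every feasible set. -/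
def IsColoop (D : SetSystem α) (e : α) : Prop := e ∈ D.ground ∧ ∀ F ∈ D.feasible, e ∈ F

variable [DecidableEq α]

/-- `(E - e, {F | F ∈ 𝓕, F ⊆ E - e})`. -/
def avoiding (D : SetSystem α) (e : α) : SetSystem α where
  ground := D.ground.erase e
  feasible := {F | F ∈ D.feasible ∧ F ⊆ D.ground.erase e}
  subset_ground := fun _ hF => hF.2

/-- `(E - e, {F - e | F ∈ 𝓕, e ∈ F})`. -/
def through (D : SetSystem α) (e : α) : SetSystem α where
  ground := D.ground.erase e
  feasible := {X | ∃ F ∈ D.feasible, e ∈ F ∧ X = F.erase e}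
  subset_ground := by
    rintro X ⟨F, hF, -, rfl⟩
    exact Finset.erase_subset_erase e (D.subset_ground F hF)

open Classical in
/-- `D ∖ e`: the feasible sets that avoid `e`, unless `e` is a coloop, when `D ∖ e = D / e`. -/
noncomputable def delete (D : SetSystem α) (e : α) : SetSystem α :=
  if D.IsColoop e then D.through e else D.avoiding e

open Classical in
/-- `D / e`: the sets `F - e` with `F` feasible and `e ∈ F`, unless `e` is a loop, when
`D / e = D ∖ e`. -/
noncomputable def contract (D : SetSystem α) (e : α) : SetSystem α :=
  if D.IsLoop e then D.avoiding e else D.through e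

/-- `IsMinor D' D`: the system `D'` is obtained from `D` by a sequence of deletions and
contractions of elements. -/
inductive IsMinor : SetSystem α → SetSystem α → Prop
  | refl (D : SetSystem α) : IsMinor D D
  | delete {D' D : SetSystem α} (h : IsMinor D' D) (e : α) (he : e ∈ D'.ground) :
      IsMinor (D'.delete e) D
  | contract {D' D : SetSystem α} (h : IsMinor D' D) (e : α) (he : e ∈ D'.ground) :
      IsMinor (D'.contract e) D

end SetSystem

/-! ## Ribbon graphs

An edge of a ribbon graph is a disc, viewed as a rectangle. Two opposite sides of the rectangle are
the line segments (the two *ends*, numbered by `Bool`) in which it meets the vertices; the other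
two sides (numbered by `Bool` too) lie on the boundary of the surface. The corner `(e, i, s)` of
the edge `e` is the point in which its end `i` meets its side `s`.

The boundary circle of a vertex that is met by at least one edge consists alternately of ends of
edges and of free arcs. A free arc joins two different corners, and each corner is an endpoint of
exactly one free arc. Hence the free arcs form a fixed-point-free involution of the set of
corners, and every such involution arises, the vertex boundaries being the closed curves that
run alternately along free arcs and ends. Up to a homeomorphism that preserves vertices and
edges, a ribbon graph is therefore given by its set of edges, this involution, and the number of
its isolated vertices. -/

/-- A corner `(e, i, s)`: the point where end `i` and side `s` of the edge `e` meet. -/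
abbrev Corner (α : Type*) := α × Bool × Bool

namespace Corner

variable {α : Type*}

/-- The other corner on the same end of the edge, that is, on the same line segment between the
edge and a vertex. -/
def acrossEnd (x : Corner α) : Corner α := (x.1, x.2.1, !x.2.2)

/-- The other corner on the same side of the edge. -/
def alongSide (x : Corner α) : Corner α := (x.1, !x.2.1, x.2.2)

/-- A way to pair off the four corners of each edge. -/
structure IsPairing (link : Corner α → Corner α) : Prop where
  edge : ∀ x, (link x).1 = x.1
  invol : ∀ x, link (link x) = x
  ne : ∀ x, link x ≠ x

theorem isPairing_acrossEnd : IsPairing (acrossEnd : Corner α → Corner α) where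
  edge _ := rfl
  invol _ := by simp [acrossEnd]
  ne x := by
    rcases x with ⟨e, i, s⟩
    cases s <;> simp [acrossEnd]

theorem isPairing_alongSide : IsPairing (alongSide : Corner α → Corner α) where
  edge _ := rfl
  invol _ := by simp [alongSide]
  ne x := by
    rcases x with ⟨e, i, s⟩
    cases i <;> simp [alongSide]

/-- The four corners of an edge are the members of two linked pairs. -/
theorem IsPairing.eq_or {e : α} {link : Corner α → Corner α} (hl : IsPairing link)
    {y y' z : Corner α} (hy : y.1 = e) (hy' : y'.1 = e) (hz : z.1 = e) (h : y' ≠ y)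
    (h' : y' ≠ link y) : z = y ∨ z = link y ∨ z = y' ∨ z = link y' := by
  have k1 : (link y).1 = e := (hl.edge y).trans hy
  have k2 : (link y').1 = e := (hl.edge y').trans hy'
  have n1 := hl.ne y
  have n2 := hl.ne y'
  have n3 : link y' ≠ y := fun hc => h' (by rw [← hc, hl.invol])
  have n4 : link y' ≠ link y := fun hc => h (by rw [← hl.invol y', hc, hl.invol])
  generalize link y = u at *
  generalize link y' = v at *
  obtain ⟨e1, p1⟩ := y
  obtain ⟨e2, p2⟩ := y'
  obtain ⟨e3, p3⟩ := z
  obtain ⟨e4, p4⟩ := u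
  obtain ⟨e5, p5⟩ := v
  simp only at hy hy' hz k1 k2
  subst hy hy' hz k1 k2
  simp only [ne_eq, Prod.mk.injEq, true_and] at *
  by_contra hc
  push Not at hc
  have hnd : [p3, p1, p4, p2, p5].Nodup := by
    simp only [List.nodup_cons, List.mem_cons, List.not_mem_nil, not_or]
    grind
  have := hnd.length_le_card
  simp at this

end Corner

/-- A (finite) ribbon graph whose edges are labelled by elements of `α`. The free arc of a vertex
boundary that starts at the corner `x` of an edge ends at the corner `arc x`; the corners of
elements of `α` that are not edges are fixed by convention. -/
structure RibbonGraph (α : Type*) where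
  edges : Finset α
  arc : Corner α → Corner α
  arc_invol : ∀ x, arc (arc x) = x
  arc_eq_self_iff : ∀ x, arc x = x ↔ x.1 ∉ edges
  /-- the number of isolated vertices -/
  isolated : ℕ

namespace RibbonGraph

variable {α : Type*}

/-- The corners of the edges of `G`. -/
abbrev Corners (G : RibbonGraph α) := {x : Corner α // x.1 ∈ G.edges}

/-- One step along the boundary of a vertex. -/
def VertexStep (G : RibbonGraph α) (x y : G.Corners) : Prop :=
  y.1 = G.arc x.1 ∨ y.1 = x.1.acrossEnd

/-- One step along the boundary of a vertex or of an edge. -/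
def ComponentStep (G : RibbonGraph α) (x y : G.Corners) : Prop :=
  y.1 = G.arc x.1 ∨ y.1 = x.1.acrossEnd ∨ y.1 = x.1.alongSide

/-- One step along the boundary of the spanning ribbon subgraph `(V, A)`: it follows the free arcs
of the vertices, the sides of the edges in `A`, and the line segments in which the removed
edges met the vertices. -/
def BoundaryStep (G : RibbonGraph α) (A : Finset α) (x y : G.Corners) : Prop :=
  y.1 = G.arc x.1 ∨ (x.1.1 ∈ A ∧ y.1 = x.1.alongSide) ∨ (x.1.1 ∉ A ∧ y.1 = x.1.acrossEnd)

/-- The vertices: the closed curves formed by free arcs and ends of edges, and the isolated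
vertices. -/
def Vertex (G : RibbonGraph α) := Quot G.VertexStep ⊕ Fin G.isolated

/-- `k(G)`, the number of connected components. -/
noncomputable def k (G : RibbonGraph α) : ℕ := Nat.card (Quot G.ComponentStep) + G.isolated

/-- `f(A)`, the number of boundary components of the spanning ribbon subgraph `(V, A)`. -/
noncomputable def f (G : RibbonGraph α) (A : Finset α) : ℕ :=
  Nat.card (Quot (G.BoundaryStep A)) + G.isolated

/-- `D(G) = (E, 𝓕)`, where `𝓕 = {A ⊆ E | f(A) = k(G)}` consists of the edge sets of the spanning
quasi-trees of `G`. -/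
noncomputable def D (G : RibbonGraph α) : SetSystem α where
  ground := G.edges
  feasible := {A | A ⊆ G.edges ∧ G.f A = G.k}
  subset_ground := fun _ hA => hA.1

variable [DecidableEq α]

/-! ### Deletion and contraction of an edge

In `G ∖ e` and in `G / e` the edge `e` is removed, and the vertex boundaries are replaced by new
closed curves. In `G ∖ e` these are the old ones, which run along the ends of `e`, now parts of
free arcs. In `G / e` they are the boundary curves of the union of `e` with its incident vertices
(and the boundaries of the other vertices), which run along the sides of `e`. In both cases a new
free arc starts along an old one; whenever it arrives at a corner of `e`, it passes to the corner
of `e` that is linked to it and continues along the old free arc there. The new curves that meet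
no edge other than `e` bound new isolated vertices. -/

/-- A curve that has arrived at a corner `y` of `e` passes through `e` to the linked corner and on
along the next free arc. -/
def pass (G : RibbonGraph α) (e : α) (link : Corner α → Corner α) (y : Corner α) : Corner α :=
  if y.1 = e then G.arc (link y) else y

/-- The new free arcs. As `e` has only four corners, an arc passes through `e` at most twice. -/
def spliceArc (G : RibbonGraph α) (e : α) (link : Corner α → Corner α) (x : Corner α) :
    Corner α :=
  if x.1 = e then x else G.pass e link (G.pass e link (G.arc x))

/-- One step along a free arc or through `e`. -/
def SpliceStep (G : RibbonGraph α) (e : α) (link : Corner α → Corner α) (x y : G.Corners) :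
    Prop :=
  y.1 = G.arc x.1 ∨ (x.1.1 = e ∧ y.1 = link x.1)

/-- The number of the closed curves formed by free arcs and passages through `e` that meet no edge
other than `e`. -/
noncomputable def closedCurves (G : RibbonGraph α) (e : α) (link : Corner α → Corner α) : ℕ :=
  Nat.card {c : Quot (G.SpliceStep e link) // ∀ x, Quot.mk _ x = c → x.1.1 = e}

theorem spliceArc_of_notMem (G : RibbonGraph α) (e : α) (link : Corner α → Corner α)
    {x : Corner α} (hx : x.1 ∉ G.edges) : G.spliceArc e link x = x := by
  have h := (G.arc_eq_self_iff x).2 hx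
  by_cases hxe : x.1 = e
  · simp [spliceArc, hxe]
  · simp [spliceArc, pass, h, hxe]

theorem spliceArc_spec (G : RibbonGraph α) (e : α) {link : Corner α → Corner α}
    (hl : Corner.IsPairing link) {x : Corner α} (hx : x.1 ≠ e) (hE : x.1 ∈ G.edges) :
    (G.spliceArc e link x).1 ≠ e ∧ G.spliceArc e link x ≠ x ∧
      G.spliceArc e link (G.spliceArc e link x) = x := by
  have inv := G.arc_invol
  have nex : ∀ z : Corner α, z.1 = e → z ≠ x := fun z hz hc => hx (hc ▸ hz)
  have fix : ∀ z : Corner α, G.arc z = z → z.1 ∉ G.edges := fun z => (G.arc_eq_self_iff z).1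
  have arcx : G.arc x ≠ x := fun h => fix x h hE
  by_cases h1 : (G.arc x).1 = e
  · have mem : e ∈ G.edges := by
      by_contra hc
      have := (G.arc_eq_self_iff (G.arc x)).2 (h1 ▸ hc)
      rw [inv] at this
      exact arcx this.symm
    have fpf : ∀ z : Corner α, z.1 = e → G.arc z ≠ z := fun z hz h => fix z h (hz ▸ mem)
    have hly : (link (G.arc x)).1 = e := (hl.edge _).trans h1
    by_cases h2 : (G.arc (link (G.arc x))).1 = e
    · set y := G.arc x with hy
      set y' := G.arc (link y) with hy'
      have hay : G.arc y = x := inv x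
      have hay' : G.arc y' = link y := inv _
      have hly' : (link y').1 = e := (hl.edge _).trans h2
      have d1 : y' ≠ y := fun hc => nex _ hly (by rw [← hay', hc, hay])
      have d2 : y' ≠ link y := fpf _ hly
      have h3 : (G.arc (link y')).1 ≠ e := by
        intro h3
        rcases hl.eq_or h1 h2 h3 d1 d2 with h | h | h | h
        · exact nex _ hly' (by rw [← inv (link y'), h, hay])
        · exact hl.ne y' (by rw [← inv (link y'), h])
        · exact d1 (by rw [← hl.invol y', ← inv (link y'), h, hay', hl.invol])
        · exact fpf _ hly' h
      have hS : G.spliceArc e link x = G.arc (link y') := by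
        simp only [spliceArc, pass, if_neg hx, ← hy, if_pos h1, ← hy', if_pos h2]
      refine ⟨hS ▸ h3, fun hc => ?_, ?_⟩
      · rw [hS] at hc
        have : link y' = y := by rw [← inv (link y'), hc]
        exact d2 (by rw [← this, hl.invol])
      · rw [hS]
        simp only [spliceArc, pass, if_neg h3, inv, if_pos hly', hl.invol, hay', if_pos hly, hay]
    · have hS : G.spliceArc e link x = G.arc (link (G.arc x)) := by
        simp only [spliceArc, pass, if_neg hx, if_pos h1, if_neg h2]
      refine ⟨hS ▸ h2, fun hc => ?_, ?_⟩
      · rw [hS] at hc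
        exact hl.ne (G.arc x) (by rw [← inv (link (G.arc x)), hc])
      · rw [hS]
        simp only [spliceArc, pass, if_neg h2, inv, if_pos hly, hl.invol, if_neg hx]
  · have hS : G.spliceArc e link x = G.arc x := by
      simp only [spliceArc, pass, if_neg hx, if_neg h1]
    refine ⟨hS ▸ h1, hS ▸ arcx, ?_⟩
    rw [hS]
    simp only [spliceArc, pass, if_neg h1, inv, if_neg hx]

/-- Removal of the edge `e`, where the new vertex boundaries pass through `e` as `link` says. -/
noncomputable def splice (G : RibbonGraph α) (e : α) (link : Corner α → Corner α)
    (hl : Corner.IsPairing link) : RibbonGraph α where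
  edges := G.edges.erase e
  arc := G.spliceArc e link
  arc_invol := fun x => by
    by_cases hx : x.1 = e
    · simp [spliceArc, hx]
    · by_cases hE : x.1 ∈ G.edges
      · exact (G.spliceArc_spec e hl hx hE).2.2
      · simp only [G.spliceArc_of_notMem e link hE]
  arc_eq_self_iff := fun x => by
    by_cases hx : x.1 = e
    · simp [spliceArc, hx]
    · by_cases hE : x.1 ∈ G.edges
      · simp [(G.spliceArc_spec e hl hx hE).2.1, hx, hE]
      · simp [G.spliceArc_of_notMem e link hE, hE]
  isolated := G.isolated + G.closedCurves e link

/-- `G ∖ e`. -/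
noncomputable def delete (G : RibbonGraph α) (e : α) : RibbonGraph α :=
  G.splice e Corner.acrossEnd Corner.isPairing_acrossEnd

/-- `G / e`. -/
noncomputable def contract (G : RibbonGraph α) (e : α) : RibbonGraph α :=
  G.splice e Corner.alongSide Corner.isPairing_alongSide

/-! ### Minors -/

open Classical in
/-- The edges that are incident with the vertex `w`. -/
noncomputable def incident (G : RibbonGraph α) (w : G.Vertex) : Finset α :=
  G.edges.filter fun e => ∃ x : G.Corners, x.1.1 = e ∧ w = Sum.inl (Quot.mk _ x)

/-- Removal of an isolated vertex. -/
def dropIsolated (G : RibbonGraph α) : RibbonGraph α :=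
  { G with isolated := G.isolated - 1 }

/-- `G ∖ w` for a vertex `w`: the edges that are incident with `w` are deleted, which makes `w` an
isolated vertex, and then this vertex is removed. -/
noncomputable def deleteVertex (G : RibbonGraph α) (w : G.Vertex) : RibbonGraph α :=
  ((G.incident w).toList.foldl delete G).dropIsolated

/-- Equivalence of ribbon graphs with the same edge labels: a homeomorphism that preserves the
vertices, the edges and their labels acts on the corners of each edge `e` by possibly exchanging
its two ends (`p e`) and possibly exchanging its two sides (`q e`). -/
def Equivalent (G H : RibbonGraph α) : Prop :=
  G.edges = H.edges ∧ G.isolated = H.isolated ∧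
    ∃ p q : α → Bool, ∀ x y : Corner α, x.1 ∈ G.edges → G.arc x = y →
      H.arc (x.1, xor (p x.1) x.2.1, xor (q x.1) x.2.2) =
        (y.1, xor (p y.1) y.2.1, xor (q y.1) y.2.2)

/-- `IsMinor H G`: the ribbon graph `H` is obtained from `G` by a sequence of edge deletions, edge
contractions and vertex deletions, ribbon graphs being considered up to equivalence. -/
inductive IsMinor : RibbonGraph α → RibbonGraph α → Prop
  | refl (G : RibbonGraph α) : IsMinor G G
  | equivalent {H G : RibbonGraph α} (h : IsMinor H G) (H' : RibbonGraph α)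
      (hH : H.Equivalent H') : IsMinor H' G
  | delete {H G : RibbonGraph α} (h : IsMinor H G) (e : α) (he : e ∈ H.edges) :
      IsMinor (H.delete e) G
  | contract {H G : RibbonGraph α} (h : IsMinor H G) (e : α) (he : e ∈ H.edges) :
      IsMinor (H.contract e) G
  | deleteVertex {H G : RibbonGraph α} (h : IsMinor H G) (w : H.Vertex) :
      IsMinor (H.deleteVertex w) G

end RibbonGraph

/-! ## Counting the classes of a relation -/

/-! Up to isolated vertices, `k` and `f A` both count classes of corners under steps along free arcs
and along links of edges: all links for `k`; for `f A`, the sides of the edges in `A` and the ends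
of the others. Deleting (`t = false`) or contracting (`t = true`) the edge `e` amounts to keeping
only the links of type `t` at `e`. By `curves_splice` no curve gets lost, because the curves that
meet only `e` become isolated vertices. So `f` of the new graph at `X` is `f` of `G` at `X`, with
`e` added when `t = true` (`f_remove`), and it remains to compare the numbers of components.

This is `k_remove_dichotomy`, which rests on parity: when all links at `e` are cut, every class
meets the corners of `e` in an even number. If the links of type `t` leave the corners of `e` in two
classes, these links are therefore redundant, and a link of the other type merges exactly these two
classes, both in the count for `k` and in the count for each `f A`.

If `k` is unchanged, the feasible sets of the new graph are those of `G` on side `t` of `e`, and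
`feasible_nonempty` excludes the exceptional case in the definition of set system deletion or
contraction. Otherwise `k` rises by one and `f` is larger by one on side `t` than on the other side.
Since `k ≤ f`, no feasible set lies on side `t`, so that `e` is a coloop (deletion) or a loop
(contraction); the two increments cancel and leave the other side. Both cases are joined in
`D_remove`. The statement on minors follows by induction on the operations. -/

theorem Quot.card_le_of_le {X : Type*} [Finite X] {r s : X → X → Prop}
    (h : ∀ x y, r x y → s x y) : Nat.card (Quot s) ≤ Nat.card (Quot r) :=
  Nat.card_le_card_of_surjective (Quot.map id h) fun c => by
    induction c using Quot.ind with
    | mk x => exact ⟨Quot.mk _ x, rfl⟩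

theorem Quot.card_congr_of_step {X : Type*} {r s : X → X → Prop}
    (h : ∀ x y, r x y → Quot.mk s x = Quot.mk s y)
    (h' : ∀ x y, s x y → Quot.mk r x = Quot.mk r y) : Nat.card (Quot r) = Nat.card (Quot s) :=
  Nat.card_congr
    { toFun := Quot.lift (Quot.mk s) h
      invFun := Quot.lift (Quot.mk r) h'
      left_inv := by rintro ⟨x⟩; rfl
      right_inv := by rintro ⟨x⟩; rfl }

/-- If the steps of `s` only identify the `r`-classes of `a` and `b`, then there is one class
less. -/
theorem Quot.card_eq_add_one {X : Type*} [Finite X] {r s : X → X → Prop} {a b : X}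
    (hab : Quot.mk r a ≠ Quot.mk r b) (h : ∀ x y, r x y → Quot.mk s x = Quot.mk s y)
    (hs : Quot.mk s a = Quot.mk s b)
    (h' : ∀ x y, s x y → Quot.mk r x = Quot.mk r y ∨
      ((Quot.mk r x = Quot.mk r a ∨ Quot.mk r x = Quot.mk r b) ∧
        (Quot.mk r y = Quot.mk r a ∨ Quot.mk r y = Quot.mk r b))) :
    Nat.card (Quot r) = Nat.card (Quot s) + 1 := by
  classical
  -- The class of `b` is redirected to that of `a`; this map induces the inverse of the projection
  -- to `Quot s`.
  let φ : X → {c : Quot r // c ≠ Quot.mk r b} := fun x =>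
    if hx : Quot.mk r x = Quot.mk r b then ⟨Quot.mk r a, hab⟩ else ⟨Quot.mk r x, hx⟩
  have hφ : ∀ x y, s x y → φ x = φ y := by
    intro x y hxy
    rcases h' x y hxy with h1 | ⟨h1 | h1, h2 | h2⟩
    · simp [φ, h1]
    all_goals simp [φ, h1, h2, hab]
  let ε : {c : Quot r // c ≠ Quot.mk r b} ≃ Quot s :=
    { toFun := fun c => Quot.lift (Quot.mk s) h c.1
      invFun := Quot.lift φ hφ
      left_inv := by
        rintro ⟨⟨x⟩, hx⟩
        exact dif_neg hx
      right_inv := by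
        rintro ⟨x⟩
        change Quot.lift (Quot.mk s) h (φ x).1 = Quot.mk s x
        by_cases hx : Quot.mk r x = Quot.mk r b
        · simp only [φ, dif_pos hx]
          exact hs.trans (congrArg (Quot.lift (Quot.mk s) h) hx).symm
        · simp only [φ, dif_neg hx] }
  rw [← Nat.card_congr ε, ← Nat.card_congr (Equiv.sumCompl fun c => c = Quot.mk r b), Nat.card_sum,
    Nat.card_unique, add_comm]

/-! ## Corners -/

namespace Corner

variable {α : Type*}

/-- The pairing of the corners of an edge along its sides (`true`) or across its ends (`false`). -/
def link : Bool → Corner α → Corner α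
  | false => acrossEnd
  | true => alongSide

theorem isPairing_link (t : Bool) : IsPairing (link t : Corner α → Corner α) := by
  cases t
  · exact isPairing_acrossEnd
  · exact isPairing_alongSide

theorem link_not_ne (t : Bool) (x : Corner α) : link (!t) x ≠ x ∧ link (!t) x ≠ link t x := by
  obtain ⟨e, i, s⟩ := x
  cases t <;> cases i <;> cases s <;> simp [link, acrossEnd, alongSide]

theorem link_not_link (t : Bool) (x : Corner α) : link (!t) (link t x) = link t (link (!t) x) := by
  cases t <;> rfl

end Corner

namespace RibbonGraph

open Corner

variable {α : Type*}

/-! ### Curves along prescribed links -/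

instance (G : RibbonGraph α) : Finite G.Corners :=
  Finite.of_injective (β := G.edges × Bool × Bool) (fun x => (⟨x.1.1, x.2⟩, x.1.2)) <| by
    rintro ⟨⟨a, p⟩, ha⟩ ⟨⟨b, q⟩, hb⟩ h
    simp_all

theorem arc_mem (G : RibbonGraph α) {x : Corner α} (hx : x.1 ∈ G.edges) :
    (G.arc x).1 ∈ G.edges := by
  by_contra h
  have h1 := (G.arc_eq_self_iff _).2 h
  rw [G.arc_invol] at h1
  exact h (h1 ▸ hx)

/-- The free arc at a corner, as a map on the corners of the edges of `G`. -/
def cornerArc (G : RibbonGraph α) (x : G.Corners) : G.Corners := ⟨G.arc x.1, G.arc_mem x.2⟩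

/-- A pairing, as a map on the corners of the edges of `G`. -/
def cornerLink (G : RibbonGraph α) (t : Bool) (x : G.Corners) : G.Corners :=
  ⟨link t x.1, by rw [(isPairing_link t).edge]; exact x.2⟩

/-- One step along a free arc, or along a link of an edge that `P` allows. -/
def Step (G : RibbonGraph α) (P : α → Bool → Prop) (x y : G.Corners) : Prop :=
  y.1 = G.arc x.1 ∨ ∃ s, P x.1.1 s ∧ y.1 = link s x.1

/-- The number of classes of corners that are connected by the steps that `P` allows. -/
noncomputable def curves (G : RibbonGraph α) (P : α → Bool → Prop) : ℕ := Nat.card (Quot (G.Step P))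

theorem Step.symm {G : RibbonGraph α} {P : α → Bool → Prop} {x y : G.Corners}
    (h : G.Step P x y) : G.Step P y x := by
  rcases h with h | ⟨s, hs, h⟩
  · exact Or.inl (by rw [h, G.arc_invol])
  · exact Or.inr ⟨s, by rwa [h, (isPairing_link s).edge], by rw [h, (isPairing_link s).invol]⟩

theorem Step.mono {G : RibbonGraph α} {P P' : α → Bool → Prop} (hP : ∀ a s, P a s → P' a s)
    {x y : G.Corners} (h : G.Step P x y) : G.Step P' x y :=
  h.imp_right fun ⟨s, hs, h⟩ => ⟨s, hP _ _ hs, h⟩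

theorem mk_cornerArc (G : RibbonGraph α) (P : α → Bool → Prop) (x : G.Corners) :
    Quot.mk (G.Step P) (G.cornerArc x) = Quot.mk _ x :=
  Eq.symm <| Quot.sound <| show G.Step P x (G.cornerArc x) from Or.inl rfl

theorem mk_cornerLink (G : RibbonGraph α) {P : α → Bool → Prop} {s : Bool} {x : G.Corners}
    (h : P x.1.1 s) : Quot.mk (G.Step P) (G.cornerLink s x) = Quot.mk _ x :=
  Eq.symm <| Quot.sound <| show G.Step P x (G.cornerLink s x) from Or.inr ⟨s, h, rfl⟩

theorem curves_anti (G : RibbonGraph α) {P P' : α → Bool → Prop} (hP : ∀ a s, P a s → P' a s) :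
    G.curves P' ≤ G.curves P :=
  Quot.card_le_of_le fun _ _ h => h.mono hP

theorem k_eq_curves (G : RibbonGraph α) : G.k = G.curves (fun _ _ => True) + G.isolated := by
  have : G.ComponentStep = G.Step fun _ _ => True := by
    ext x y
    simp [ComponentStep, Step, link]
  rw [k, curves, this]

theorem f_eq_curves (G : RibbonGraph α) (A : Finset α) :
    G.f A = G.curves (fun a s => a ∈ A ↔ s = true) + G.isolated := by
  have : G.BoundaryStep A = G.Step fun a s => a ∈ A ↔ s = true := by
    ext x y
    simp [BoundaryStep, Step, link, or_comm]
  rw [f, curves, this]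

/-- Forbidding links can only split classes. -/
theorem k_le_f (G : RibbonGraph α) (A : Finset α) : G.k ≤ G.f A := by
  rw [k_eq_curves, f_eq_curves]
  exact Nat.add_le_add_right (G.curves_anti fun _ _ _ => trivial) _

/-! ## The two ends of an edge in the complement of that edge -/

/-- A closed curve that is linked up at every corner except at those of `e` meets `e` in an even
number of corners. -/
theorem exists_ne_mk_eq (G : RibbonGraph α) {P : α → Bool → Prop} {e : α}
    (hP : ∀ a, a ≠ e → ∃ s, P a s) (x : G.Corners) (hx : x.1.1 = e) :
    ∃ y : G.Corners, y.1.1 = e ∧ y ≠ x ∧ Quot.mk (G.Step P) y = Quot.mk _ x := by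
  classical
  by_contra! hc
  have := Fintype.ofFinite G.Corners
  choose! σ hσ using hP
  let C : Finset G.Corners := {y | Quot.mk (G.Step P) y = Quot.mk _ x}
  have hC : ∀ y, y ∈ C ↔ Quot.mk (G.Step P) y = Quot.mk _ x := by simp [C]
  have hne : ∀ y ∈ C.erase x, y.1.1 ≠ e := fun y hy hye =>
    hc y hye (Finset.ne_of_mem_erase hy) ((hC y).1 (Finset.mem_of_mem_erase hy))
  -- If `x` were the only corner of `e` in its class `C`, free arcs would pair off `C`, and one
  -- chosen link per edge would pair off `C` without `x`: both would have even size.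
  have h1 : ∑ _y ∈ C, (1 : ZMod 2) = 0 := by
    refine Finset.sum_involution (fun y _ => G.cornerArc y) (fun _ _ => by decide) ?_ ?_ ?_
    · intro y _ _ h
      exact (G.arc_eq_self_iff y.1).1 (congrArg Subtype.val h) y.2
    · intro y hy
      rw [hC, mk_cornerArc, (hC y).1 hy]
    · intro y _
      exact Subtype.ext (G.arc_invol y.1)
  have h2 : ∑ _y ∈ C.erase x, (1 : ZMod 2) = 0 := by
    refine Finset.sum_involution (fun y _ => G.cornerLink (σ y.1.1) y) (fun _ _ => by decide)
      ?_ ?_ ?_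
    · intro y _ _ h
      exact (isPairing_link _).ne y.1 (congrArg Subtype.val h)
    · intro y hy
      have hye := hne y hy
      refine Finset.mem_erase.2 ⟨fun h => hye ?_, ?_⟩
      · rw [← hx, ← h]
        exact ((isPairing_link _).edge y.1).symm
      · rw [hC, mk_cornerLink _ (hσ _ hye), (hC y).1 (Finset.mem_of_mem_erase hy)]
    · intro y _
      apply Subtype.ext
      change link (σ (link (σ y.1.1) y.1).1) (link (σ y.1.1) y.1) = y.1
      rw [(isPairing_link _).edge, (isPairing_link _).invol]
  rw [← Finset.sum_erase_add C _ ((hC x).2 rfl), h2] at h1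
  exact absurd h1 (by decide)

theorem corner_cases (G : RibbonGraph α) (t : Bool) {x y : G.Corners} (h : y.1.1 = x.1.1) :
    y = x ∨ y = G.cornerLink t x ∨ y = G.cornerLink (!t) x ∨
      y = G.cornerLink t (G.cornerLink (!t) x) := by
  have hn := link_not_ne t x.1
  simpa only [Subtype.ext_iff, cornerLink] using
    (isPairing_link t).eq_or (y := x.1) (y' := link (!t) x.1) (z := y.1) rfl
      ((isPairing_link (!t)).edge x.1) h hn.1 hn.2

/-! ### Changing the links at one edge -/

variable [DecidableEq α]

/-- `P` away from `e`, and only the links of type `t` at `e`. -/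
def restrictAt (P : α → Bool → Prop) (e : α) (t : Bool) (a : α) (s : Bool) : Prop :=
  if a = e then s = t else P a s

/-- The links of type `t` and the one given connection put all four corners of `e` into one class,
so further links at `e` join nothing new. -/
theorem curves_eq_of_mk_eq (G : RibbonGraph α) {P : α → Bool → Prop} {e : α} {t : Bool}
    (hP : ∀ s, P e s) {x : G.Corners} (hx : x.1.1 = e)
    (h : Quot.mk (G.Step (restrictAt P e t)) (G.cornerLink (!t) x) = Quot.mk _ x) :
    G.curves (restrictAt P e t) = G.curves P := by
  have all : ∀ y : G.Corners, y.1.1 = e → Quot.mk (G.Step (restrictAt P e t)) y = Quot.mk _ x := by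
    intro y hy
    rcases G.corner_cases t (hy.trans hx.symm) with rfl | rfl | rfl | rfl
    · rfl
    · exact G.mk_cornerLink (by simp [restrictAt, hx])
    · exact h
    · refine (G.mk_cornerLink ?_).trans h
      have : (G.cornerLink (!t) x).1.1 = e := ((isPairing_link _).edge x.1).trans hx
      simp [restrictAt, this]
  refine Quot.card_congr_of_step (fun y z hyz => Quot.sound (hyz.mono fun a s has => ?_)) ?_
  · by_cases ha : a = e
    · exact ha ▸ hP s
    · simpa [restrictAt, ha] using has
  · rintro y z (hyz | ⟨s, hs, hyz⟩)
    · exact Quot.sound (Or.inl hyz)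
    · by_cases hy : y.1.1 = e
      · rw [all y hy, all z (by rw [hyz, (isPairing_link s).edge, hy])]
      · exact Quot.sound (Or.inr ⟨s, by simpa [restrictAt, hy] using hs, hyz⟩)

/-- The two pairs of type `t` at `e` lie in different classes. By parity each pair is connected even
without its link, so the count does not depend on whether `P'` allows type `t` at `e`, and the links
of the other type merge just these two classes. -/
theorem curves_eq_add_one (G : RibbonGraph α) {P P' : α → Bool → Prop} {e : α} {t : Bool}
    (hP : ∀ a, a ≠ e → ∃ s, P a s) (hP' : ∀ a, a ≠ e → ∀ s, P' a s ↔ P a s) (he : P' e (!t))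
    {x : G.Corners} (hx : x.1.1 = e)
    (h : Quot.mk (G.Step (restrictAt P e t)) (G.cornerLink (!t) x) ≠ Quot.mk _ x) :
    G.curves (restrictAt P e t) = G.curves P' + 1 := by
  set R := restrictAt P e t
  -- All links at `e` are cut, which gives a relation below both `R` and `P'`.
  let B : α → Bool → Prop := fun a s => a ≠ e ∧ P a s
  have hBR : ∀ a s, B a s → R a s := fun a s hB => by simp [R, restrictAt, hB.1, hB.2]
  have hBP : ∀ a s, B a s → P' a s := fun a s hB => (hP' a hB.1 s).2 hB.2
  have lift {Q : α → Bool → Prop} (hQ : ∀ a s, B a s → Q a s) {y z : G.Corners}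
      (hyz : Quot.mk (G.Step B) y = Quot.mk _ z) : Quot.mk (G.Step Q) y = Quot.mk _ z :=
    congrArg (Quot.map id fun _ _ hst => Step.mono hQ hst) hyz
  have edge (s : Bool) (y : G.Corners) : (G.cornerLink s y).1.1 = y.1.1 :=
    (isPairing_link s).edge y.1
  have hRt (y : G.Corners) (hy : y.1.1 = e) :
      Quot.mk (G.Step R) (G.cornerLink t y) = Quot.mk _ y :=
    G.mk_cornerLink (by simp [R, restrictAt, hy])
  -- the links of type `t` at `e` join corners that are already connected
  have key (y : G.Corners) (hy : y.1.1 = e)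
      (hy' : Quot.mk (G.Step R) (G.cornerLink (!t) y) ≠ Quot.mk _ y) :
      Quot.mk (G.Step B) (G.cornerLink t y) = Quot.mk _ y := by
    obtain ⟨z, hz, hzy, hm⟩ := G.exists_ne_mk_eq (P := B) (e := e)
      (fun a ha => (hP a ha).imp fun s hs => ⟨ha, hs⟩) y hy
    -- The second corner supplied by parity cannot belong to the other pair, as the two pairs would
    -- then be connected.
    rcases G.corner_cases t (hz.trans hy.symm) with rfl | rfl | rfl | rfl
    · exact absurd rfl hzy
    · exact hm
    · exact absurd (lift hBR hm) hy'
    · exact absurd ((hRt _ ((edge _ _).trans hy)).symm.trans (lift hBR hm)) hy'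
  have invol : G.cornerLink (!t) (G.cornerLink (!t) x) = x :=
    Subtype.ext ((isPairing_link _).invol x.1)
  have key₁ := key x hx h
  have key₂ := key (G.cornerLink (!t) x) ((edge _ _).trans hx) (by rw [invol]; exact h.symm)
  have cls (y : G.Corners) (hy : y.1.1 = e) :
      Quot.mk (G.Step R) y = Quot.mk _ (G.cornerLink (!t) x) ∨
        Quot.mk (G.Step R) y = Quot.mk _ x := by
    rcases G.corner_cases t (hy.trans hx.symm) with rfl | rfl | rfl | rfl
    · exact Or.inr rfl
    · exact Or.inr (lift hBR key₁)
    · exact Or.inl rfl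
    · exact Or.inl (lift hBR key₂)
  refine Quot.card_eq_add_one h ?_ (G.mk_cornerLink (hx ▸ he)) ?_
  · rintro y z (hyz | ⟨s, hs, hyz⟩)
    · exact Quot.sound (Or.inl hyz)
    · by_cases hy : y.1.1 = e
      · obtain rfl : s = t := by simpa [R, restrictAt, hy] using hs
        obtain rfl : z = G.cornerLink s y := Subtype.ext hyz
        refine (lift hBP (key y hy fun hc => h ?_)).symm
        -- Whichever corner of `e` is `y`, a connection to its partner of the other type yields one
        -- between `x` and the partner of `x`.
        rcases G.corner_cases s (hy.trans hx.symm) with rfl | rfl | rfl | rfl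
        · exact hc
        · have e1 : G.cornerLink (!s) (G.cornerLink s x) = G.cornerLink s (G.cornerLink (!s) x) :=
            Subtype.ext (link_not_link s x.1)
          rwa [e1, hRt _ ((edge _ _).trans hx), hRt _ hx] at hc
        · rw [invol] at hc
          exact hc.symm
        · have e1 : G.cornerLink (!s) (G.cornerLink s (G.cornerLink (!s) x)) =
              G.cornerLink s x := by
            apply Subtype.ext
            change link (!s) (link s (link (!s) x.1)) = link s x.1
            rw [link_not_link, (isPairing_link _).invol]
          rw [e1, hRt _ hx, hRt _ ((edge _ _).trans hx)] at hc
          exact hc.symm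
      · exact Quot.sound (Or.inr ⟨s, (hP' _ hy s).2 (by simpa [R, restrictAt, hy] using hs), hyz⟩)
  · rintro y z (hyz | ⟨s, hs, hyz⟩)
    · exact Or.inl (Quot.sound (Or.inl hyz))
    · by_cases hy : y.1.1 = e
      · exact Or.inr ⟨cls y hy, cls z (by rw [hyz, (isPairing_link s).edge, hy])⟩
      · exact Or.inl (Quot.sound (Or.inr ⟨s, by
          simpa [R, restrictAt, hy] using (hP' _ hy s).1 hs, hyz⟩))

/-! ## Curves in a spliced ribbon graph -/

/-- Where the curve that leaves `e` at the corner `x` first meets another edge, if it passes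
through `e` at most once more. -/
def exitCorner (G : RibbonGraph α) (e : α) (link : Corner α → Corner α) (x : Corner α) :
    Corner α :=
  if x.1 = e then G.pass e link (G.arc x) else x

/-- Two corners are both on `e`, or equal, or joined by a free arc of the spliced ribbon graph. -/
def SpliceRel (G : RibbonGraph α) (e : α) (link : Corner α → Corner α) (x y : Corner α) : Prop :=
  (x.1 = e ∧ y.1 = e) ∨ x = y ∨ G.spliceArc e link x = y

/-- This and the next lemma let a class of `G` be followed into the spliced graph through exit
corners. As `e` has four corners, a curve still on `e` at its exit corner never leaves `e`. -/
theorem spliceRel_exitCorner_arc (G : RibbonGraph α) {e : α} {link : Corner α → Corner α}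
    (hl : IsPairing link) {x : Corner α} (hx : x.1 ∈ G.edges) :
    G.SpliceRel e link (G.exitCorner e link x) (G.exitCorner e link (G.arc x)) := by
  have inv := G.arc_invol
  by_cases h1 : x.1 = e
  · have fpf : ∀ z : Corner α, z.1 = e → G.arc z ≠ z := fun z hz h =>
      (G.arc_eq_self_iff z).1 h (hz ▸ h1 ▸ hx)
    by_cases h2 : (G.arc x).1 = e
    · have e1 : G.exitCorner e link x = G.arc (link (G.arc x)) := by
        simp [exitCorner, pass, h1, h2]
      have e2 : G.exitCorner e link (G.arc x) = G.arc (link x) := by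
        simp [exitCorner, pass, h1, h2, inv]
      have hlx : (link x).1 = e := (hl.edge x).trans h1
      have hly : (link (G.arc x)).1 = e := (hl.edge _).trans h2
      rw [e1, e2]
      by_cases h3 : G.arc x = link x
      · exact Or.inl ⟨by rw [h3, hl.invol, h2], by rw [← h3, inv, h1]⟩
      have four : ∀ z : Corner α, z.1 = e → z = x ∨ z = link x ∨ z = G.arc x ∨ z = link (G.arc x) :=
        fun z hz => hl.eq_or h1 h2 hz (fpf x h1) h3
      -- In this case the free arcs pair the four corners of `e` among themselves.
      by_cases h4 : (G.arc (link (G.arc x))).1 = e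
      · refine Or.inl ⟨h4, ?_⟩
        rcases four _ h4 with h | h | h | h
        · exact absurd (by rw [← inv (link (G.arc x)), h]) (hl.ne (G.arc x))
        · rw [← h, inv, hly]
        · exact absurd (by rw [← hl.invol (G.arc x), ← inv (link (G.arc x)), h, inv]) h3
        · exact absurd h (fpf _ hly)
      · refine Or.inr (Or.inr ?_)
        simp [spliceArc, pass, h4, inv, hly, hl.invol, h1]
    · refine Or.inr (Or.inl ?_)
      simp [exitCorner, pass, h1, h2]
  · refine Or.inr ?_
    by_cases h2 : (G.arc x).1 = e
    · left
      simp [exitCorner, pass, h1, h2, inv]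
    · right
      simp [exitCorner, spliceArc, pass, h1, h2]

/-- The two directions spare a proof that `SpliceRel` is symmetric: the new arc is read from an end
that is off `e`, if there is one. -/
theorem spliceRel_exitCorner_link (G : RibbonGraph α) {e : α} {link : Corner α → Corner α}
    (hl : IsPairing link) {x : Corner α} (hx : x.1 ∈ G.edges) (h1 : x.1 = e) :
    G.SpliceRel e link (G.exitCorner e link x) (G.exitCorner e link (link x)) ∨
      G.SpliceRel e link (G.exitCorner e link (link x)) (G.exitCorner e link x) := by
  have inv := G.arc_invol
  have fpf : ∀ z : Corner α, z.1 = e → G.arc z ≠ z := fun z hz h =>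
    (G.arc_eq_self_iff z).1 h (hz ▸ h1 ▸ hx)
  have hlx : (link x).1 = e := (hl.edge x).trans h1
  by_cases hu : (G.arc x).1 = e
  · by_cases hv : (G.arc (link x)).1 = e
    · refine Or.inl (Or.inl ?_)
      have e1 : G.exitCorner e link x = G.arc (link (G.arc x)) := by
        simp [exitCorner, pass, h1, hu]
      have e2 : G.exitCorner e link (link x) = G.arc (link (G.arc (link x))) := by
        simp [exitCorner, pass, hlx, hv]
      rw [e1, e2]
      by_cases h3 : G.arc x = link x
      · have h4 : G.arc (link x) = x := by rw [← h3, inv]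
        exact ⟨by rw [h3, hl.invol, hu], by rw [h4, hv]⟩
      · rcases hl.eq_or h1 hu hv (fpf x h1) h3 with h | h | h | h
        · exact absurd (by rw [← inv (link x), h]) h3
        · exact absurd h (fpf _ hlx)
        · exact absurd (by rw [← inv (link x), h, inv]) (hl.ne x)
        · exact ⟨by rw [← h, inv, hlx], by rw [h, hl.invol, inv, h1]⟩
    · refine Or.inr (Or.inr (Or.inr ?_))
      simp [exitCorner, spliceArc, pass, h1, hlx, hu, hv, inv, hl.invol]
  · refine Or.inl (Or.inr (Or.inr ?_))
    by_cases hv : (G.arc (link x)).1 = e <;>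
      simp [exitCorner, spliceArc, pass, h1, hlx, hu, hv, inv]

/-- The curves that pass through `e` as `link t` says are the curves of the spliced ribbon graph
and the closed curves that meet no other edge. -/
theorem curves_splice (G : RibbonGraph α) {P : α → Bool → Prop} {e : α} {t : Bool}
    (hP : ∀ s, P e s ↔ s = t) :
    G.curves P = (G.splice e (link t) (isPairing_link t)).curves P +
      G.closedCurves e (link t) := by
  classical
  set hl := isPairing_link (α := α) t
  set G' := G.splice e (link t) hl
  have memG' (x : Corner α) : x.1 ∈ G'.edges ↔ x.1 ≠ e ∧ x.1 ∈ G.edges := Finset.mem_erase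
  let ι : G'.Corners → G.Corners := fun x => ⟨x.1, ((memG' x.1).1 x.2).2⟩
  -- the class in `G'` of a corner
  let cls : Corner α → Option (Quot (G'.Step P)) := fun z =>
    if h : z.1 ∈ G'.edges then some (Quot.mk _ ⟨z, h⟩) else none
  have cls_arc (z : Corner α) : cls (G.spliceArc e (link t) z) = cls z := by
    by_cases hz : z.1 ∈ G'.edges
    · have hz' : (G.spliceArc e (link t) z).1 ∈ G'.edges := G'.arc_mem hz
      simp only [cls, dif_pos hz, dif_pos hz']
      exact congrArg some (G'.mk_cornerArc P ⟨z, hz⟩)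
    · rw [show G.spliceArc e (link t) z = z from (G'.arc_eq_self_iff z).2 hz]
  have cls_rel {y z : Corner α} (h : G.SpliceRel e (link t) y z) : cls y = cls z := by
    rcases h with ⟨hy, hz⟩ | rfl | h
    · have hy' : y.1 ∉ G'.edges := fun hc => ((memG' y).1 hc).1 hy
      have hz' : z.1 ∉ G'.edges := fun hc => ((memG' z).1 hc).1 hz
      simp only [cls, dif_neg hy', dif_neg hz']
    · rfl
    · rw [← h, cls_arc]
  -- The value `none` collects the curves that never leave `e`. On classes, `Φ` is a left inverse of
  -- the map `Ψ` below, which makes `Ψ` injective.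
  let Φ : G.Corners → Option (Quot (G'.Step P)) := fun x => cls (G.exitCorner e (link t) x.1)
  have hΦ : ∀ x y, G.Step P x y → Φ x = Φ y := by
    rintro x y (h | ⟨s, hs, h⟩)
    · simp only [Φ, h]
      exact cls_rel (G.spliceRel_exitCorner_arc hl x.2)
    · by_cases hx : x.1.1 = e
      · obtain rfl : s = t := (hP s).1 (hx ▸ hs)
        simp only [Φ, h]
        rcases G.spliceRel_exitCorner_link hl x.2 hx with h' | h'
        · exact cls_rel h'
        · exact (cls_rel h').symm
      · have hy : y.1.1 = x.1.1 := by rw [h, (isPairing_link s).edge]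
        have hx' : x.1.1 ∈ G'.edges := (memG' _).2 ⟨hx, x.2⟩
        have hy' : y.1.1 ∈ G'.edges := hy ▸ hx'
        simp only [Φ, exitCorner, hy, hx, if_false, cls, dif_pos hx']
        exact congrArg some (Quot.sound (Or.inr ⟨s, hs, h⟩))
  have mk_pass (y : G.Corners) : ∃ h, Quot.mk (G.Step P) ⟨G.pass e (link t) y.1, h⟩ =
      Quot.mk (G.Step P) y := by
    by_cases hy : y.1.1 = e
    · have : G.pass e (link t) y.1 = (G.cornerArc (G.cornerLink t y)).1 := by
        simp only [pass, if_pos hy]; rfl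
      simp only [this]
      exact ⟨(G.cornerArc (G.cornerLink t y)).2,
        (G.mk_cornerArc P _).trans (G.mk_cornerLink (by rw [hy, hP]))⟩
    · have : G.pass e (link t) y.1 = y.1 := by simp only [pass, if_neg hy]
      simp only [this]
      exact ⟨y.2, trivial⟩
  have hι : ∀ x y, G'.Step P x y → Quot.mk (G.Step P) (ι x) = Quot.mk _ (ι y) := by
    rintro x y (h | ⟨s, hs, h⟩)
    · have hx := ((memG' x.1).1 x.2).1
      obtain ⟨h1, h1'⟩ := mk_pass (G.cornerArc (ι x))
      obtain ⟨h2, h2'⟩ := mk_pass ⟨_, h1⟩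
      have : ι y = ⟨_, h2⟩ := Subtype.ext (h.trans (if_neg hx))
      rw [this, h2', h1', mk_cornerArc]
    · exact Quot.sound (Or.inr ⟨s, hs, h⟩)
  let Ψ : Quot (G'.Step P) → Quot (G.Step P) := Quot.lift (fun x => Quot.mk _ (ι x)) hι
  have hΨ : ∀ c, Quot.lift Φ hΦ (Ψ c) = some c := by
    rintro ⟨x⟩
    have hx := ((memG' x.1).1 x.2).1
    change cls (G.exitCorner e (link t) x.1) = _
    simp only [exitCorner, if_neg hx, cls, dif_pos x.2]
  have hinj : Function.Injective Ψ := fun c d h =>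
    Option.some_injective _ (by rw [← hΨ, h, hΨ])
  have hrange (c : Quot (G.Step P)) :
      c ∉ Set.range Ψ ↔ ∀ x, Quot.mk _ x = c → x.1.1 = e := by
    constructor
    · intro hc x hx
      by_contra hne
      exact hc ⟨Quot.mk _ ⟨x.1, (memG' _).2 ⟨hne, x.2⟩⟩, hx⟩
    · rintro hc ⟨⟨x⟩, hx⟩
      exact ((memG' x.1).1 x.2).1 (hc (ι x) hx)
  -- the other classes are the closed curves
  have hSP : ∀ x y, G.SpliceStep e (link t) x y → G.Step P x y := by
    rintro x y (h | ⟨hx, h⟩)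
    · exact Or.inl h
    · exact Or.inr ⟨t, by rw [hx, hP], h⟩
  -- A splice class within `e` is already a full class of `P`, since at `e` both relations allow
  -- only the link `t`.
  have hclosed (x : G.Corners)
      (hx : ∀ y, Quot.mk (G.SpliceStep e (link t)) y = Quot.mk _ x → y.1.1 = e) (y : G.Corners)
      (hxy : Relation.EqvGen (G.Step P) x y) :
      Quot.mk (G.SpliceStep e (link t)) y = Quot.mk _ x := by
    have hR : ∀ y z, G.Step P y z → Quot.mk (G.SpliceStep e (link t)) y = Quot.mk _ x →
        Quot.mk (G.SpliceStep e (link t)) z = Quot.mk _ x := by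
      rintro y z (h | ⟨s, hs, h⟩) hy
      · rw [← hy]
        exact (Quot.sound (show G.SpliceStep e (link t) y z from Or.inl h)).symm
      · have hye := hx y hy
        obtain rfl : s = t := (hP s).1 (hye ▸ hs)
        rw [← hy]
        exact (Quot.sound (show G.SpliceStep e (link s) y z from Or.inr ⟨hye, h⟩)).symm
    have : ∀ y z, Relation.EqvGen (G.Step P) y z →
        (Quot.mk (G.SpliceStep e (link t)) y = Quot.mk _ x ↔
          Quot.mk (G.SpliceStep e (link t)) z = Quot.mk _ x) := by
      intro y z h
      induction h with
      | rel y z h => exact ⟨hR y z h, hR z y h.symm⟩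
      | refl => rfl
      | symm _ _ _ ih => exact ih.symm
      | trans _ _ _ _ _ ih ih' => exact ih.trans ih'
    exact (this x y hxy).1 rfl
  let Θ : {c : Quot (G.SpliceStep e (link t)) // ∀ x, Quot.mk _ x = c → x.1.1 = e} →
      {c : Quot (G.Step P) // c ∉ Set.range Ψ} := fun c =>
    ⟨Quot.map id hSP c.1, by
      obtain ⟨⟨x⟩, hx⟩ := c
      rw [hrange]
      intro y hy
      exact hx y (hclosed x hx y (Quot.eqvGen_exact hy).symm)⟩
  have hΘ : Function.Bijective Θ := by
    constructor
    · rintro ⟨⟨x⟩, hx⟩ ⟨⟨y⟩, hy⟩ h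
      exact Subtype.ext (hclosed x hx y (Quot.eqvGen_exact (congrArg Subtype.val h))).symm
    · rintro ⟨⟨x⟩, hx⟩
      refine ⟨⟨Quot.mk _ x, fun y hy => (hrange _).1 hx y ?_⟩, rfl⟩
      exact congrArg (Quot.map id hSP) hy
  rw [closedCurves, Nat.card_congr (Equiv.ofBijective Θ hΘ), curves, curves,
    Nat.card_congr (Equiv.ofInjective Ψ hinj), ← Nat.card_sum]
  exact (Nat.card_congr (Equiv.sumCompl fun c => c ∈ Set.range Ψ)).symm

end RibbonGraph

/-! ## Delta-matroids of deletions and contractions -/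

namespace SetSystem

variable {α : Type*} [DecidableEq α]

/-- The set `X`, with `e` added if `t` is `true`. -/
def extend (e : α) (t : Bool) (X : Finset α) : Finset α := if t then insert e X else X

theorem mem_extend {e : α} {t : Bool} {X : Finset α} {a : α} :
    a ∈ extend e t X ↔ (a = e ∧ t = true) ∨ a ∈ X := by
  cases t <;> simp [extend]

/-- The feasible sets through `e` (`true`) or avoiding `e` (`false`). -/
def side (D : SetSystem α) (e : α) : Bool → SetSystem α
  | false => D.avoiding e
  | true => D.through e

theorem ground_side (D : SetSystem α) (e : α) (t : Bool) :
    (D.side e t).ground = D.ground.erase e := by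
  cases t <;> rfl

theorem mem_feasible_side {D : SetSystem α} {e : α} {t : Bool} {X : Finset α} :
    X ∈ (D.side e t).feasible ↔ e ∉ X ∧ extend e t X ∈ D.feasible := by
  cases t
  · change X ∈ D.feasible ∧ X ⊆ D.ground.erase e ↔ e ∉ X ∧ X ∈ D.feasible
    refine ⟨fun h => ⟨fun he => by simpa using h.2 he, h.1⟩, fun h => ⟨h.2, ?_⟩⟩
    exact Finset.subset_erase.2 ⟨D.subset_ground X h.2, h.1⟩
  · change (∃ F ∈ D.feasible, e ∈ F ∧ X = F.erase e) ↔ e ∉ X ∧ insert e X ∈ D.feasible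
    constructor
    · rintro ⟨F, hF, he, rfl⟩
      exact ⟨by simp, by rwa [Finset.insert_erase he]⟩
    · rintro ⟨he, hX⟩
      exact ⟨_, hX, by simp, by simp [he]⟩

open Classical in
-- Deletion and contraction are brought to one shape with a parameter `t`, that of `D_remove`: side
-- `t`, unless every feasible set lies on the other side.
theorem delete_eq (D : SetSystem α) {e : α} (he : e ∈ D.ground) :
    D.delete e = if ∀ F ∈ D.feasible, e ∈ F ↔ (!false) = true then D.side e (!false)
      else D.side e false := by
  simp [delete, IsColoop, he, side]

open Classical in
theorem contract_eq (D : SetSystem α) {e : α} (he : e ∈ D.ground) :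
    D.contract e = if ∀ F ∈ D.feasible, e ∈ F ↔ (!true) = true then D.side e (!true)
      else D.side e true := by
  simp [contract, IsLoop, he, side]

end SetSystem

namespace RibbonGraph

open Corner SetSystem

variable {α : Type*}

/-! ### Isolated vertices and equivalence -/

theorem curves_congr (G : RibbonGraph α) {P P' : α → Bool → Prop}
    (h : ∀ a ∈ G.edges, ∀ s, P a s ↔ P' a s) : G.curves P = G.curves P' := by
  have : G.Step P = G.Step P' := by
    ext x y
    simp only [Step, h _ x.2]
  rw [curves, curves, this]

/-- Isolated vertices contribute equally to `f A` and to `k`, so their number cancels. -/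
theorem D_dropIsolated (G : RibbonGraph α) : G.dropIsolated.D = G.D := by
  refine SetSystem.ext rfl (Set.ext fun A => and_congr_right fun _ => ?_)
  change Nat.card (Quot (G.BoundaryStep A)) + _ = Nat.card (Quot G.ComponentStep) + _ ↔
    Nat.card (Quot (G.BoundaryStep A)) + _ = Nat.card (Quot G.ComponentStep) + _
  rw [Nat.add_right_cancel_iff, Nat.add_right_cancel_iff]

/-- Exchanging ends or sides edge by edge is an involution of the corners that commutes with both
types of link and carries free arcs to free arcs. -/
theorem Equivalent.curves_eq {G H : RibbonGraph α} (h : G.Equivalent H)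
    (P : α → Bool → Prop) : G.curves P = H.curves P := by
  obtain ⟨hE, -, p, q, hpq⟩ := h
  let φ : Corner α → Corner α := fun x => (x.1, xor (p x.1) x.2.1, xor (q x.1) x.2.2)
  have hφ (x : Corner α) : φ (φ x) = x := by simp [φ]
  have hlink (s : Bool) (x : Corner α) : φ (link s x) = link s (φ x) := by
    cases s <;> simp [φ, link, acrossEnd, alongSide]
  have harc (x : Corner α) (hx : x.1 ∈ G.edges) : H.arc (φ x) = φ (G.arc x) := hpq x _ hx rfl
  let ε : G.Corners ≃ H.Corners :=
    { toFun := fun x => ⟨φ x.1, hE.subset x.2⟩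
      invFun := fun x => ⟨φ x.1, hE.superset x.2⟩
      left_inv := fun x => Subtype.ext (hφ x.1)
      right_inv := fun x => Subtype.ext (hφ x.1) }
  have inj : Function.Injective φ := Function.LeftInverse.injective hφ
  refine Nat.card_congr (Quot.congr ε fun x y => ?_)
  change _ ↔ φ y.1 = H.arc (φ x.1) ∨ ∃ s, P x.1.1 s ∧ φ y.1 = link s (φ x.1)
  simp only [harc x.1 x.2, ← hlink, inj.eq_iff]
  rfl

theorem Equivalent.D_eq {G H : RibbonGraph α} (h : G.Equivalent H) : H.D = G.D := by
  refine SetSystem.ext h.1.symm (Set.ext fun A => ?_)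
  change A ⊆ H.edges ∧ H.f A = H.k ↔ A ⊆ G.edges ∧ G.f A = G.k
  rw [h.1, f_eq_curves, k_eq_curves, f_eq_curves, k_eq_curves, h.curves_eq, h.curves_eq, h.2.1]

/-! ### Deletion and contraction of one edge -/

variable [DecidableEq α]

/-- Either the removal of `e` along the links of type `t` does not disconnect the ribbon graph, or
it splits off one curve from every system of closed curves. -/
theorem curves_restrictAt_dichotomy (G : RibbonGraph α) {e : α} (he : e ∈ G.edges) (t : Bool) :
    G.curves (restrictAt (fun _ _ => True) e t) = G.curves (fun _ _ => True) ∨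
      ∀ P P' : α → Bool → Prop, (∀ a, a ≠ e → ∃ s, P a s) →
        (∀ a, a ≠ e → ∀ s, P' a s ↔ P a s) → P' e (!t) →
          G.curves (restrictAt P e t) = G.curves P' + 1 := by
  let x : G.Corners := ⟨(e, false, false), he⟩
  refine or_iff_not_imp_left.2 fun h P P' hP hP' hPe => ?_
  refine G.curves_eq_add_one hP hP' hPe (x := x) rfl fun hc => h ?_
  refine G.curves_eq_of_mk_eq (fun _ => trivial) (x := x) rfl ?_
  -- A connection through links allowed by `P` persists when all links away from `e` are allowed.
  refine congrArg (Quot.map id fun _ _ hst => Step.mono (fun a s has => ?_) hst) hc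
  by_cases ha : a = e <;> simp_all [restrictAt]

/-- The ribbon graph with the edge `e` deleted (`false`) or contracted (`true`). -/
noncomputable def remove (G : RibbonGraph α) (e : α) (t : Bool) : RibbonGraph α :=
  G.splice e (link t) (isPairing_link t)

theorem k_remove (G : RibbonGraph α) (e : α) (t : Bool) :
    (G.remove e t).k = G.curves (restrictAt (fun _ _ => True) e t) + G.isolated := by
  have h : (G.remove e t).curves (fun _ _ => True) =
      (G.remove e t).curves (restrictAt (fun _ _ => True) e t) :=
    curves_congr _ fun a ha s => by simp [restrictAt, Finset.ne_of_mem_erase ha]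
  rw [k_eq_curves, h, G.curves_splice (e := e) (t := t) (fun s => by simp [restrictAt])]
  change _ + (G.isolated + _) = _
  rw [remove]
  omega

theorem f_remove (G : RibbonGraph α) {e : α} (t : Bool) {A : Finset α} (hA : e ∉ A) :
    (G.remove e t).f A = G.f (extend e t A) := by
  have h : (G.remove e t).curves (fun a s => a ∈ A ↔ s = true) =
      (G.remove e t).curves (fun a s => a ∈ extend e t A ↔ s = true) :=
    curves_congr _ fun a ha s => by simp [mem_extend, Finset.ne_of_mem_erase ha]
  rw [f_eq_curves, f_eq_curves, h, G.curves_splice (e := e) (t := t)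
    (fun s => by cases s <;> cases t <;> simp [mem_extend, hA])]
  change _ + (G.isolated + _) = _
  rw [remove]
  omega

/-- In the second case `e` is a bridge if `t = false`, and a loop whose contraction splits its
component if `t = true`. -/
theorem k_remove_dichotomy (G : RibbonGraph α) {e : α} (he : e ∈ G.edges) (t : Bool) :
    (G.remove e t).k = G.k ∨
      ((G.remove e t).k = G.k + 1 ∧ (G.remove e (!t)).k = G.k ∧
        ∀ A : Finset α, e ∉ A → G.f (extend e t A) = G.f (extend e (!t) A) + 1) := by
  rcases G.curves_restrictAt_dichotomy he t with h | h
  · left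
    rw [k_remove, h, k_eq_curves]
  · right
    -- The split is compared with three relations: all links (`h1`), only the other type at `e`
    -- (`h2`), and the boundary of a spanning subgraph (`h3`).
    have h1 := h (fun _ _ => True) (fun _ _ => True) (fun _ _ => ⟨true, trivial⟩)
      (fun _ _ _ => Iff.rfl) trivial
    have h2 := h (fun _ _ => True) (restrictAt (fun _ _ => True) e (!t))
      (fun _ _ => ⟨true, trivial⟩) (fun a ha s => by simp [restrictAt, ha]) (by simp [restrictAt])
    refine ⟨by rw [k_remove, k_eq_curves]; omega, by rw [k_remove, k_eq_curves]; omega, ?_⟩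
    intro A hA
    have h3 := h (fun a s => a ∈ extend e t A ↔ s = true)
      (fun a s => a ∈ extend e (!t) A ↔ s = true)
      (fun a _ => ⟨decide (a ∈ extend e t A), by simp⟩)
      (fun a ha s => by simp [mem_extend, ha]) (by cases t <;> simp [mem_extend, hA])
    have h4 : G.curves (restrictAt (fun a s => a ∈ extend e t A ↔ s = true) e t) =
        G.curves (fun a s => a ∈ extend e t A ↔ s = true) := by
      refine G.curves_congr fun a _ s => ?_
      by_cases ha : a = e
      · subst ha
        cases s <;> cases t <;> simp [restrictAt, mem_extend, hA]
      · simp [restrictAt, ha]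
    rw [f_eq_curves, f_eq_curves]
    omega

theorem extend_subset_edges {G : RibbonGraph α} {e : α} (he : e ∈ G.edges) {t : Bool}
    {A : Finset α} (hA : A ⊆ G.edges.erase e) : extend e t A ⊆ G.edges := by
  intro a ha
  rcases mem_extend.1 ha with ⟨rfl, -⟩ | ha
  · exact he
  · exact Finset.mem_of_mem_erase (hA ha)

theorem mem_feasible_remove {G : RibbonGraph α} {e : α} (he : e ∈ G.edges) {t : Bool}
    (hk : (G.remove e t).k = G.k) {A : Finset α} :
    A ∈ (G.remove e t).D.feasible ↔ e ∉ A ∧ extend e t A ∈ G.D.feasible := by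
  change A ⊆ G.edges.erase e ∧ (G.remove e t).f A = (G.remove e t).k ↔
    e ∉ A ∧ extend e t A ⊆ G.edges ∧ G.f (extend e t A) = G.k
  constructor
  · rintro ⟨hA, hf⟩
    have heA : e ∉ A := fun h => by simpa using hA h
    exact ⟨heA, extend_subset_edges he hA, by rw [← f_remove G t heA, hf, hk]⟩
  · rintro ⟨heA, hA, hf⟩
    refine ⟨Finset.subset_erase.2 ⟨fun a ha => hA (mem_extend.2 (Or.inr ha)), heA⟩, ?_⟩
    rw [f_remove G t heA, hf, hk]

/-- Every ribbon graph has a spanning quasi-tree. -/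
theorem feasible_nonempty (G : RibbonGraph α) : G.D.feasible.Nonempty := by
  induction hn : G.edges.card generalizing G with
  | zero =>
    have hE : G.edges = ∅ := Finset.card_eq_zero.1 hn
    refine ⟨∅, Finset.empty_subset _, ?_⟩
    rw [f_eq_curves, k_eq_curves, G.curves_congr (P' := fun _ _ => True) (by simp [hE])]
  | succ n ih =>
    obtain ⟨e, he⟩ : G.edges.Nonempty := Finset.card_pos.1 (by omega)
    -- Deletion and contraction cannot both raise `k`; a feasible set of the graph that keeps `k`
    -- lifts to `G`.
    obtain ⟨t, ht⟩ : ∃ t, (G.remove e t).k = G.k := by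
      rcases G.k_remove_dichotomy he false with h | ⟨-, h, -⟩
      exacts [⟨_, h⟩, ⟨_, h⟩]
    obtain ⟨A, hA⟩ := ih (G.remove e t)
      (show (G.edges.erase e).card = n by rw [Finset.card_erase_of_mem he, hn]; rfl)
    exact ⟨_, ((mem_feasible_remove he ht).1 hA).2⟩

open Classical in
theorem D_remove (G : RibbonGraph α) {e : α} (he : e ∈ G.edges) (t : Bool) :
    (G.remove e t).D = if ∀ F ∈ G.D.feasible, e ∈ F ↔ (!t) = true then G.D.side e (!t)
      else G.D.side e t := by
  have hg (s : Bool) : (G.remove e t).D.ground = (G.D.side e s).ground := by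
    rw [ground_side]; rfl
  rcases G.k_remove_dichotomy he t with hk | ⟨hk, -, hf⟩
  · obtain ⟨A, hA⟩ := (G.remove e t).feasible_nonempty
    rw [mem_feasible_remove he hk] at hA
    rw [if_neg fun h => ?_]
    · exact SetSystem.ext (hg t) (Set.ext fun X => by
        rw [mem_feasible_remove he hk, mem_feasible_side])
    · have := h _ hA.2
      cases t <;> simp [mem_extend, hA.1] at this
  · rw [if_pos]
    · refine SetSystem.ext (hg _) (Set.ext fun X => ?_)
      rw [mem_feasible_side]
      change X ⊆ G.edges.erase e ∧ (G.remove e t).f X = (G.remove e t).k ↔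
        e ∉ X ∧ extend e (!t) X ⊆ G.edges ∧ G.f (extend e (!t) X) = G.k
      constructor
      · rintro ⟨hX, h⟩
        have heX : e ∉ X := fun h => by simpa using hX h
        -- Both sides of the feasibility equation gain one, so it becomes that of the other side.
        rw [f_remove G t heX, hf X heX, hk] at h
        exact ⟨heX, extend_subset_edges he hX, by omega⟩
      · rintro ⟨heX, hX, h⟩
        refine ⟨Finset.subset_erase.2 ⟨fun a ha => hX (mem_extend.2 (Or.inr ha)), heX⟩, ?_⟩
        rw [f_remove G t heX, hf X heX, h, hk]
    · rintro F ⟨-, hF⟩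
      by_contra hc
      have hFt : F = extend e t (F.erase e) := by
        ext a
        rw [mem_extend, Finset.mem_erase]
        by_cases ha : a = e
        · subst ha
          cases t <;> simp_all
        · simp [ha]
      -- Switching `e` to the other side would lower `f` from `k` to `k - 1`, against `k ≤ f`.
      have h1 := hf (F.erase e) (by simp)
      rw [← hFt, hF] at h1
      have h2 := G.k_le_f (extend e (!t) (F.erase e))
      omega

theorem D_delete (G : RibbonGraph α) {e : α} (he : e ∈ G.edges) :
    (G.delete e).D = G.D.delete e := by
  classical
  exact (G.D_remove he false).trans (G.D.delete_eq he).symm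

theorem D_contract (G : RibbonGraph α) {e : α} (he : e ∈ G.edges) :
    (G.contract e).D = G.D.contract e := by
  classical
  exact (G.D_remove he true).trans (G.D.contract_eq he).symm

/-! ## Minors -/

/-- As the entries of `l` are distinct, each is still an edge when its turn comes; this serves
vertex deletion. -/
theorem isMinor_D_foldl_delete {D : SetSystem α} (l : List α) (G : RibbonGraph α)
    (hG : G.D.IsMinor D) (hl : l.Nodup) (hE : ∀ e ∈ l, e ∈ G.edges) :
    (l.foldl RibbonGraph.delete G).D.IsMinor D := by
  induction l generalizing G with
  | nil => exact hG
  | cons e l ih =>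
    have he : e ∈ G.edges := hE e (by simp)
    rw [List.nodup_cons] at hl
    refine ih (G.delete e) ?_ hl.2 fun a ha => ?_
    · rw [G.D_delete he]
      exact hG.delete e he
    · exact Finset.mem_erase.2 ⟨fun h => hl.1 (h ▸ ha), hE a (List.mem_cons_of_mem _ ha)⟩

theorem IsMinor.isMinor_D {G H : RibbonGraph α} (h : H.IsMinor G) : H.D.IsMinor G.D := by
  induction h with
  | refl G => exact .refl _
  | equivalent _ H' hH ih => rwa [hH.D_eq]
  | delete _ e he ih =>
    rw [D_delete _ he]
    exact ih.delete e he
  | contract _ e he ih =>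
    rw [D_contract _ he]
    exact ih.contract e he
  | @deleteVertex H _ _ w ih =>
    rw [RibbonGraph.deleteVertex, D_dropIsolated]
    refine isMinor_D_foldl_delete _ _ ih (Finset.nodup_toList _) fun e he => ?_
    classical
    exact Finset.filter_subset _ _ (Finset.mem_toList.1 he)

end RibbonGraph

theorem propositionp {α : Type*} [DecidableEq α] (G : RibbonGraph α) :
    (∀ e ∈ G.edges, (G.delete e).D = G.D.delete e ∧ (G.contract e).D = G.D.contract e) ∧
      ∀ H : RibbonGraph α, H.IsMinor G → H.D.IsMinor G.D := by
  exact ⟨fun _ he => ⟨G.D_delete he, G.D_contract he⟩, fun _ hH => hH.isMinor_D⟩
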